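/- **Setting.** Let $\mathfrak X=(X,\{R_i\}_{i=0}^4)$ be a symmetric association scheme of class 4 with intersection numbers $p_{i,j}^k$ such that $R_4$ has valency one, $R_0\cup R_4$ is an equivalence relation, and the classes of the relation "$j\sim k$ iff $p_{i,j}^k\ne0$ for some $i\in\{0,4\}$" on the indices are $\{0,4\},\{1,3\},\{2\}$. Let $\overline{\mathfrak X}$ be the quotient scheme of class 2 on the set $\overline X$ of $n=|X|/2$ classes of $R_0\cup R_4$, with relations $\overline R_0,\overline R_1,\overline R_2$ induced by $R_0\cup R_4$, $R_1\cup R_3$, $R_2$. Let $\overline E_0=\frac1nJ,\overline E_1,\overline E_2$ be its primitive idempotents, ordered so that its second eigenmatrix is $$\overline Q=\begin{pmatrix}1&m&n-m-1\\1&r&-r-1\\1&s&-s-1\end{pmatrix},\qquad r>s.$$ Order the primitive idempotents $E_0,\dots,E_4$ of $\mathfrak X$ so that $E_i=\frac12\overline E_i\otimes J_2$ for $i=0,1,2$. Let $A_i$ be the adjacency matrix of $R_i$, and define the eigenmatrices $P,Q$ of $\mathfrak X$ by $A_i=\sum_jP_{ji}E_j$ and $E_i=\frac1{|X|}\sum_jQ_{ji}A_j$.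 For $i=3,4$ put $m_i=Q_{0i}$ (the multiplicity of $E_i$) and $\alpha_i=Q_{1i}/m_i$. Let $Y_1,\dots,Y_f$ be a partition of $X$ such that for every $j$ one has $\{i: R_i\cap(Y_j\times Y_j)\neq\emptyset\}=\{0,2,4\}$ and $|Y_j|=2(1-P_{0,2}/\theta)$, where $\theta=\min\{P_{1,2},P_{2,2}\}$. The fission scheme $\tilde{\mathfrak X}$ on $X$ has the relations $\tilde R_i=R_i$ for $i=0,1,3,4$, $\tilde R_5=R_2\cap\bigcup_j(Y_j\times Y_j)$ and $\tilde R_2=R_2\setminus\tilde R_5$. Put $\tilde E_3=E_3$ and $\tilde E_4=E_4$. **Theorem 4.1.** Each relation $\tilde R_i$ has a constant valency $\tilde k_i$, and $$\tilde k_0+\tilde k_4+\tilde k_5\le\min\{2m_3,2m_4\}.$$ If $i\in\{3,4\}$ and $\tilde k_0+\tilde k_4+\tilde k_5=2m_i$, then: 1. The spherical embedding $x\mapsto\sqrt{|X|/m_i}\,\tilde E_ie_x$ (with $e_x$ the standard basis vector at $x$) into the eigenspace $\tilde E_i\mathbb R^X$ has the cross-polytope decomposition $Y_1,\dots,Y_f$: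 it maps each $Y_j$ bijectively onto $\{\pm b_1,\dots,\pm b_{m_i}\}$ for some orthonormal basis $b_1,\dots,b_{m_i}$ of $\tilde E_i\mathbb R^X$. 2. We have $f\ge2$, and there is a family of $f-1$ (not necessarily distinct) mutually unbiased weighing matrices of order $1-\frac ms$ and weight $1/\alpha_i^2$. Here a weighing matrix of order $N$ and weight $w$ is an $N\times N$ matrix $W$ with entries in $\{0,1,-1\}$ and $WW^{T}=wI$. A family $(W_a)$ of such matrices is mutually unbiased if for all $a\ne b$ the matrix $\frac1{\sqrt w}W_aW_b^{T}$ is again a weighing matrix of order $N$ and weight $w$. -/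

import Mathlib

noncomputable section

/-- A symmetric association scheme of class `d` on the finite set `X`, with relations
`R 0, …, R d` and intersection numbers `p i j k` (usually written `p_{i,j}^k`). -/
structure AssociationScheme (X : Type*) [Fintype X] (d : ℕ) where
  R : Fin (d + 1) → X → X → Prop
  p : Fin (d + 1) → Fin (d + 1) → Fin (d + 1) → ℕ
  nonempty : ∀ i, ∃ x y, R i x y
  zero_iff : ∀ x y, R 0 x y ↔ x = y
  partition : ∀ x y, ∃! i, R i x y
  symm : ∀ i x y, R i x y → R i y x
  inter : ∀ i j k x y, R k x y → {z | R i x z ∧ R j z y}.ncard = p i j k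

open Classical in
/-- The real `(0,1)`-matrix of a binary relation. -/
def relMatrix {X : Type*} (R : X → X → Prop) : Matrix X X ℝ :=
  Matrix.of fun x y => if R x y then 1 else 0

/-- `E 0 = J / |X|, E 1, …, E d` are the primitive idempotents of the Bose–Mesner algebra, that is,
of the span of the adjacency matrices of `R 0, …, R d`: they are `d + 1` nonzero mutually
orthogonal idempotents of this `(d + 1)`-dimensional algebra with sum the identity. -/
structure IsPrimitiveIdempotents {X : Type*} [Fintype X] [DecidableEq X] {d : ℕ}
    (R : Fin (d + 1) → X → X → Prop) (E : Fin (d + 1) → Matrix X X ℝ) : Prop where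
  mem : ∀ i, E i ∈ Submodule.span ℝ (Set.range fun j => relMatrix (R j))
  ne_zero : ∀ i, E i ≠ 0
  idem : ∀ i, E i * E i = E i
  orth : ∀ i j, i ≠ j → E i * E j = 0
  sum_eq : ∑ i, E i = 1
  zero_eq : E 0 = (Fintype.card X : ℝ)⁻¹ • Matrix.of fun _ _ => 1

/-- The first eigenmatrix `P`: `A_i = ∑_j P_{j i} E_j`. -/
def IsFirstEigenmatrix {X : Type*} {d : ℕ} (R : Fin (d + 1) → X → X → Prop)
    (E : Fin (d + 1) → Matrix X X ℝ) (P : Matrix (Fin (d + 1)) (Fin (d + 1)) ℝ) : Prop :=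
  ∀ i, relMatrix (R i) = ∑ j, P j i • E j

/-- The second eigenmatrix `Q`: `E_i = |X|⁻¹ ∑_j Q_{j i} A_j`.
The multiplicity of `E_i` is `m_i = Q_{0 i}`. -/
def IsSecondEigenmatrix {X : Type*} [Fintype X] {d : ℕ} (R : Fin (d + 1) → X → X → Prop)
    (E : Fin (d + 1) → Matrix X X ℝ) (Q : Matrix (Fin (d + 1)) (Fin (d + 1)) ℝ) : Prop :=
  ∀ i, E i = (Fintype.card X : ℝ)⁻¹ • ∑ j, Q j i • relMatrix (R j)

namespace AssociationScheme

variable {X : Type*} [Fintype X]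

/-- A four-class scheme which is a two-fold cover of a two-class scheme: `R 4` has valency one,
`R 0 ∪ R 4` is an equivalence relation, and the classes of the relation
"`p_{i,j}^k ≠ 0` for some `i ∈ {0, 4}`" on the indices are `{0, 4}`, `{1, 3}`, `{2}`
(`Fin.rev k` is `4 - k`). -/
structure IsTwofoldCover (S : AssociationScheme X 4) : Prop where
  valency : ∀ x, {y | S.R 4 x y}.ncard = 1
  equiv : Equivalence fun x y => S.R 0 x y ∨ S.R 4 x y
  classes : ∀ j k, (∃ i ∈ ({0, 4} : Set (Fin 5)), S.p i j k ≠ 0) ↔ (j = k ∨ j = Fin.rev k)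

variable {S : AssociationScheme X 4}

/-- The vertex set of the quotient scheme with respect to `R 0 ∪ R 4`. -/
def IsTwofoldCover.Quo (h : S.IsTwofoldCover) : Type _ :=
  Quotient (⟨_, h.equiv⟩ : Setoid X)

/-- The quotient map. -/
def IsTwofoldCover.proj (h : S.IsTwofoldCover) (x : X) : h.Quo :=
  Quotient.mk (⟨_, h.equiv⟩ : Setoid X) x

instance (h : S.IsTwofoldCover) : Fintype h.Quo :=
  @Fintype.ofFinite _ (inferInstanceAs (Finite (Quotient (⟨_, h.equiv⟩ : Setoid X))))

instance (h : S.IsTwofoldCover) : DecidableEq h.Quo := Classical.decEq _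

/-- The relations of the quotient scheme; they come from `R 0 ∪ R 4`, `R 1 ∪ R 3` and `R 2`. -/
def IsTwofoldCover.quoRel (h : S.IsTwofoldCover) (j : Fin 3) (a b : h.Quo) : Prop :=
  ∃ x y, h.proj x = a ∧ h.proj y = b ∧
    ∃ i ∈ (![{0, 4}, {1, 3}, {2}] : Fin 3 → Set (Fin 5)) j, S.R i x y

/-- `Y` is an `I`-clique: the relations met by `Y × Y` are exactly those with index in `I`. -/
def IsClique {d : ℕ} (S : AssociationScheme X d) (I : Set (Fin (d + 1))) (Y : Set X) : Prop :=
  {i | ∃ x ∈ Y, ∃ y ∈ Y, S.R i x y} = I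

/-- A partition `Y 0, …, Y (f - 1)` of `X` into `{0, 2, 4}`-cliques attaining the Hoffman–Delsarte
bound `2 (1 - P_{0,2} / θ)`, `θ = min (P_{1,2}, P_{2,2})`. -/
structure IsSpread (S : AssociationScheme X 4) (P : Matrix (Fin 5) (Fin 5) ℝ) {f : ℕ}
    (Y : Fin f → Set X) : Prop where
  clique : ∀ j, S.IsClique {0, 2, 4} (Y j)
  card : ∀ j, ((Y j).ncard : ℝ) = 2 * (1 - P 0 2 / min (P 1 2) (P 2 2))
  cover : ⋃ j, Y j = Set.univ
  disjoint : Pairwise fun i j => Disjoint (Y i) (Y j)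

/-- The relations of the fission scheme: `R 2` is split into the pairs inside a common `Y j`
(index `5`) and the remaining pairs (index `2`). -/
def fissionRel (S : AssociationScheme X 4) {f : ℕ} (Y : Fin f → Set X) :
    Fin 6 → X → X → Prop :=
  ![S.R 0, S.R 1, fun x y => S.R 2 x y ∧ ¬ ∃ j, x ∈ Y j ∧ y ∈ Y j, S.R 3, S.R 4,
    fun x y => S.R 2 x y ∧ ∃ j, x ∈ Y j ∧ y ∈ Y j]

end AssociationScheme

/-- The eigenspace (column space) of an idempotent. -/
def idemSpace {X : Type*} [Fintype X] [DecidableEq X] (E : Matrix X X ℝ) :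
    Submodule ℝ (EuclideanSpace ℝ X) :=
  LinearMap.range (Matrix.toEuclideanLin E)

/-- The spherical embedding `x ↦ √(|X| / μ) E e_x` via an idempotent `E` of multiplicity `μ`. -/
def sphericalEmbedding {X : Type*} [Fintype X] (E : Matrix X X ℝ) (μ : ℝ) (x : X) :
    EuclideanSpace ℝ X :=
  WithLp.toLp 2 fun y => √((Fintype.card X : ℝ) / μ) * E y x

/-- `C` is a cross-polytope of the Euclidean space `V`: an orthonormal basis of `V` together with
the negatives of its vectors. -/
def IsCrossPolytope {F : Type*} [NormedAddCommGroup F] [InnerProductSpace ℝ F]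
    (V : Submodule ℝ F) (C : Set F) : Prop :=
  ∃ b : OrthonormalBasis (Fin (Module.finrank ℝ V)) ℝ V,
    C = (Set.range fun t => (b t : F)) ∪ Set.range fun t => -(b t : F)

/-- A family `Y` of sets of points is a cross-polytope decomposition of the point set with respect
to the map `φ` into `V`: the sets partition the point set, and `φ` maps each of them bijectively
onto a cross-polytope of `V`. -/
structure IsCrossPolytopeDecomposition {X F : Type*} [NormedAddCommGroup F]
    [InnerProductSpace ℝ F] (V : Submodule ℝ F) (φ : X → F) {f : ℕ} (Y : Fin f → Set X) :
    Prop where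
  cover : ⋃ j, Y j = Set.univ
  disjoint : Pairwise fun i j => Disjoint (Y i) (Y j)
  injOn : ∀ j, Set.InjOn φ (Y j)
  crossPolytope : ∀ j, IsCrossPolytope V (φ '' Y j)

/-- Weighing matrices of order `N` and weight `w`. -/
structure IsWeighingMatrix {N : ℕ} (W : Matrix (Fin N) (Fin N) ℝ) (w : ℕ) : Prop where
  entry : ∀ a b, W a b = 0 ∨ W a b = 1 ∨ W a b = -1
  mul_transpose : W * W.transpose = (w : ℝ) • (1 : Matrix (Fin N) (Fin N) ℝ)

/-- Mutually unbiased weighing matrices of order `N` and weight `w`: for distinct indices,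
`W i (W j)ᵀ` is `√w` times a weighing matrix of weight `w`. -/
structure IsMutuallyUnbiasedWeighing {ι : Type*} {N : ℕ} (W : ι → Matrix (Fin N) (Fin N) ℝ)
    (w : ℕ) : Prop where
  weighing : ∀ i, IsWeighingMatrix (W i) w
  unbiased : Pairwise fun i j =>
    ∃ V : Matrix (Fin N) (Fin N) ℝ, IsWeighingMatrix V w ∧ W i * (W j).transpose = √(w : ℝ) • V

end

/-! The relation `R 4` pairs each point with an antipode, and replacing a point by its antipode
turns `R k` into `R (4 - k)`. The sum `E 0 + E 1 + E 2` projects onto the functions constant on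
antipodal pairs, so `E 3` and `E 4`, being orthogonal to it, are odd under the antipodal map. Hence
`Q 2 i = 0`, `Q 3 i = - Q 1 i` and `Q 4 i = - Q 0 i` for `i = 3, 4`. In the spherical embedding
antipodes become negatives, points in `R 2` become orthogonal, and all other distinct pairs have
inner product `±α_i`.

The prescribed clique size equals `2 (1 - m / s)` (`spread_parameters`), the Hoffman–Delsarte bound
for `E 1` (`card_clique_le`). Adding all antipodes to `Y j` gives a clique of the same kind, still
subject to this bound, so `Y j` already contains them (`antipode_mem_of_card_eq`). One point from
each antipodal pair of `Y j` then gives an orthonormal family in a space of dimension `m_i`. This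
proves `|Y j| ≤ 2 m_i`; under equality the family is a basis and `Y j` maps onto a cross-polytope.

Under equality the bases from different cliques have transition matrices with entries `0, ±α_i`.
These matrices are orthogonal and compose, so rescaling those relative to one fixed clique gives the
mutually unbiased weighing matrices. -/

open Module

/-! ### Symmetric idempotents and their spherical embeddings -/

section Idempotent

variable {X : Type*} [Fintype X] [DecidableEq X]

theorem mem_idemSpace_of_col (E : Matrix X X ℝ) (c : ℝ) (x : X) :
    (WithLp.toLp 2 fun y => c * E y x : EuclideanSpace ℝ X) ∈ idemSpace E := by
  refine ⟨WithLp.toLp 2 (Pi.single x c), ?_⟩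
  rw [Matrix.toLpLin_toLp]
  congr 1
  ext y
  simp [mul_comm]

theorem finrank_idemSpace {E : Matrix X X ℝ} (hE : E * E = E) :
    (finrank ℝ (idemSpace E) : ℝ) = E.trace := by
  have hidem : Matrix.toEuclideanLin E * Matrix.toEuclideanLin E = Matrix.toEuclideanLin E := by
    ext v : 1
    simp [Matrix.toLpLin_apply, Module.End.mul_apply, Matrix.mulVec_mulVec, hE]
  have hproj : LinearMap.IsProj (idemSpace E) (Matrix.toEuclideanLin E) := by
    refine ⟨fun v => ⟨v, rfl⟩, ?_⟩
    rintro _ ⟨v, rfl⟩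
    exact LinearMap.congr_fun hidem v
  rw [← hproj.trace, Matrix.toEuclideanLin, Matrix.toLpLin_eq_toLin, Matrix.trace_toLin_eq]

/-- Symmetric idempotents are positive semidefinite. -/
theorem sum_sum_nonneg_of_idem {X : Type*} [Fintype X] {E : Matrix X X ℝ} (hE : E * E = E)
    (hs : ∀ x y, E x y = E y x)
    (C : Finset X) : 0 ≤ ∑ x ∈ C, ∑ y ∈ C, E x y := by
  have key : ∑ x ∈ C, ∑ y ∈ C, E x y = ∑ z, (∑ x ∈ C, E x z) ^ 2 := by
    calc ∑ x ∈ C, ∑ y ∈ C, E x y = ∑ x ∈ C, ∑ y ∈ C, ∑ z, E x z * E y z := by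
          refine Finset.sum_congr rfl fun x _ => Finset.sum_congr rfl fun y _ => ?_
          conv_lhs => rw [← hE, Matrix.mul_apply]
          exact Finset.sum_congr rfl fun z _ => by rw [hs z y]
      _ = ∑ z, (∑ x ∈ C, E x z) ^ 2 := by
          simp_rw [sq, Finset.sum_mul_sum]
          rw [Finset.sum_comm (s := Finset.univ)]
          exact Finset.sum_congr rfl fun x _ => Finset.sum_comm
  rw [key]
  positivity

theorem inner_sphericalEmbedding {X : Type*} [Fintype X] {E : Matrix X X ℝ} (hE : E * E = E)
    (hs : ∀ x y, E x y = E y x)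
    {μ : ℝ} (hμ : 0 ≤ μ) (x y : X) :
    inner ℝ (sphericalEmbedding E μ x) (sphericalEmbedding E μ y) =
      (Fintype.card X : ℝ) / μ * E x y := by
  have hc : 0 ≤ (Fintype.card X : ℝ) / μ := by positivity
  conv_rhs => rw [← hE, Matrix.mul_apply, Finset.mul_sum]
  rw [PiLp.inner_apply]
  refine Finset.sum_congr rfl fun z _ => ?_
  simp only [sphericalEmbedding, RCLike.inner_apply, conj_trivial]
  rw [hs x z]
  linear_combination (E z x * E z y) * Real.mul_self_sqrt hc

end Idempotent

/-! ### Eigenmatrices of a symmetric scheme -/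

namespace AssociationScheme

variable {X : Type*} [Fintype X] {d : ℕ} (S : AssociationScheme X d)

theorem eq_of_rel {i j : Fin (d + 1)} {x y : X} (hi : S.R i x y) (hj : S.R j x y) : i = j :=
  (S.partition x y).unique hi hj

theorem sum_smul_relMatrix_apply (c : Fin (d + 1) → ℝ) {k : Fin (d + 1)} {x y : X}
    (hk : S.R k x y) : (∑ j, c j • relMatrix (S.R j)) x y = c k := by
  rw [Matrix.sum_apply, Finset.sum_eq_single k]
  · simp [relMatrix, hk]
  · intro j _ hj
    have : ¬ S.R j x y := fun h' => hj (S.eq_of_rel h' hk)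
    simp [relMatrix, this]
  · simp

theorem ncard_rel (i : Fin (d + 1)) (x : X) : {y | S.R i x y}.ncard = S.p i i 0 := by
  rw [← S.inter i i 0 x x ((S.zero_iff x x).2 rfl)]
  congr 1
  ext z
  exact ⟨fun hz => ⟨hz, S.symm _ _ _ hz⟩, fun hz => hz.1⟩

theorem p_pos (i : Fin (d + 1)) : 0 < S.p i i 0 := by
  obtain ⟨x, y, hxy⟩ := S.nonempty i
  rw [← S.ncard_rel i x]
  exact (Set.ncard_pos (Set.toFinite _)).2 ⟨y, hxy⟩

variable {S}

theorem _root_.IsSecondEigenmatrix.apply {E : Fin (d + 1) → Matrix X X ℝ}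
    {Q : Matrix (Fin (d + 1)) (Fin (d + 1)) ℝ} (hQ : IsSecondEigenmatrix S.R E Q)
    (i : Fin (d + 1)) {k : Fin (d + 1)} {x y : X} (hk : S.R k x y) :
    E i x y = (Fintype.card X : ℝ)⁻¹ * Q k i := by
  rw [hQ i, Matrix.smul_apply, S.sum_smul_relMatrix_apply (fun j => Q j i) hk, smul_eq_mul]

theorem _root_.IsSecondEigenmatrix.symm {E : Fin (d + 1) → Matrix X X ℝ}
    {Q : Matrix (Fin (d + 1)) (Fin (d + 1)) ℝ} (hQ : IsSecondEigenmatrix S.R E Q)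
    (i : Fin (d + 1)) (x y : X) : E i x y = E i y x := by
  obtain ⟨k, hk, -⟩ := S.partition x y
  rw [hQ.apply i hk, hQ.apply i (S.symm _ _ _ hk)]

theorem _root_.IsSecondEigenmatrix.card_mul_diag {E : Fin (d + 1) → Matrix X X ℝ}
    {Q : Matrix (Fin (d + 1)) (Fin (d + 1)) ℝ} (hQ : IsSecondEigenmatrix S.R E Q)
    (i : Fin (d + 1)) (x : X) : (Fintype.card X : ℝ) * E i x x = Q 0 i := by
  have : (Fintype.card X : ℝ) ≠ 0 := by
    have : Nonempty X := ⟨x⟩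
    exact_mod_cast Fintype.card_ne_zero
  rw [hQ.apply i ((S.zero_iff x x).2 rfl), mul_inv_cancel_left₀ this]

variable [DecidableEq X]

theorem _root_.IsFirstEigenmatrix.mul_idem {R : Fin (d + 1) → X → X → Prop}
    {E : Fin (d + 1) → Matrix X X ℝ}
    {P : Matrix (Fin (d + 1)) (Fin (d + 1)) ℝ} (hP : IsFirstEigenmatrix R E P)
    (hE : IsPrimitiveIdempotents R E) (i j : Fin (d + 1)) :
    relMatrix (R i) * E j = P j i • E j := by
  rw [hP i, Matrix.sum_mul, Finset.sum_eq_single j]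
  · rw [Matrix.smul_mul, hE.idem]
  · intro l _ hl
    rw [Matrix.smul_mul, hE.orth l j hl, smul_zero]
  · simp

/-- A diagonal entry of a symmetric idempotent is the sum of squares of its row, so a nonpositive
constant diagonal would force `E i = 0`. -/
theorem _root_.IsPrimitiveIdempotents.trace_pos {E : Fin (d + 1) → Matrix X X ℝ}
    {Q : Matrix (Fin (d + 1)) (Fin (d + 1)) ℝ} (hE : IsPrimitiveIdempotents S.R E)
    (hQ : IsSecondEigenmatrix S.R E Q) (i : Fin (d + 1)) : 0 < Q 0 i := by
  obtain ⟨x, -, -⟩ := S.nonempty 0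
  have hX : (0 : ℝ) < Fintype.card X := by
    have : Nonempty X := ⟨x⟩
    exact_mod_cast Fintype.card_pos
  have hdiag : ∀ y, E i y y = ∑ z, E i y z ^ 2 := fun y => by
    conv_lhs => rw [← hE.idem i, Matrix.mul_apply]
    exact Finset.sum_congr rfl fun z _ => by rw [hQ.symm i z y, sq]
  by_contra hneg
  apply hE.ne_zero i
  ext y z
  have h1 : E i y y ≤ 0 := by
    have := hQ.card_mul_diag i y
    by_contra hlt
    push Not at hlt
    have := mul_pos hX hlt
    linarith
  have h2 : E i y z ^ 2 ≤ 0 := by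
    refine le_trans ?_ h1
    rw [hdiag]
    exact Finset.single_le_sum (f := fun z => E i y z ^ 2) (fun _ _ => sq_nonneg _)
      (Finset.mem_univ z)
  exact pow_eq_zero_iff (two_ne_zero) |>.1 (le_antisymm h2 (sq_nonneg _))

theorem _root_.IsPrimitiveIdempotents.finrank_idemSpace {E : Fin (d + 1) → Matrix X X ℝ}
    {Q : Matrix (Fin (d + 1)) (Fin (d + 1)) ℝ} (hE : IsPrimitiveIdempotents S.R E)
    (hQ : IsSecondEigenmatrix S.R E Q) (i : Fin (d + 1)) :
    (finrank ℝ (idemSpace (E i)) : ℝ) = Q 0 i := by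
  rw [_root_.finrank_idemSpace (hE.idem i), Matrix.trace]
  obtain ⟨x, -, -⟩ := S.nonempty 0
  have : ∀ y ∈ Finset.univ, (E i).diag y = E i x x := fun y _ => by
    rw [Matrix.diag_apply, hQ.apply i ((S.zero_iff y y).2 rfl),
      hQ.apply i ((S.zero_iff x x).2 rfl)]
  rw [Finset.sum_congr rfl this, Finset.sum_const, Finset.card_univ, nsmul_eq_mul,
    hQ.card_mul_diag i x]

theorem sum_relMatrix_row {X : Type*} [Fintype X] {S : AssociationScheme X d}
    (i : Fin (d + 1)) (x : X) :
    ∑ z, relMatrix (S.R i) x z = S.p i i 0 := by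
  classical
  rw [← S.ncard_rel i x, Set.ncard_eq_toFinset_card']
  simp [relMatrix, Finset.sum_boole]

/-- `E 0` is constant, so `A_i E_0` records row sums of `A_i`, which are valencies. -/
theorem firstEigenmatrix_zero {E : Fin (d + 1) → Matrix X X ℝ}
    {P : Matrix (Fin (d + 1)) (Fin (d + 1)) ℝ} (hE : IsPrimitiveIdempotents S.R E)
    (hP : IsFirstEigenmatrix S.R E P) (i : Fin (d + 1)) : P 0 i = S.p i i 0 := by
  obtain ⟨x, -, -⟩ := S.nonempty 0
  have hX : (Fintype.card X : ℝ) ≠ 0 := by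
    have : Nonempty X := ⟨x⟩
    exact_mod_cast Fintype.card_ne_zero
  have := congr_fun₂ (hP.mul_idem hE i 0) x x
  rw [hE.zero_eq, Matrix.mul_apply] at this
  simp only [Matrix.smul_apply, Matrix.of_apply, smul_eq_mul, mul_one] at this
  rw [← Finset.sum_mul, sum_relMatrix_row] at this
  exact (mul_right_cancel₀ (inv_ne_zero hX) this).symm

end AssociationScheme

/-! ### The antipodal map and the quotient -/

namespace AssociationScheme.IsTwofoldCover

variable {X : Type*} [Fintype X] {S : AssociationScheme X 4} (h : S.IsTwofoldCover)

theorem mem_indexClass_iff (j : Fin 3) (i : Fin 5) :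
    i ∈ (![{0, 4}, {1, 3}, {2}] : Fin 3 → Set (Fin 5)) j ↔
      (![0, 1, 2, 1, 0] : Fin 5 → Fin 3) i = j := by
  fin_cases j <;> fin_cases i <;> simp

theorem exists_antipode (h : S.IsTwofoldCover) (x : X) : ∃ y, ∀ z, S.R 4 x z ↔ z = y := by
  obtain ⟨y, hy⟩ := Set.ncard_eq_one.1 (h.valency x)
  exact ⟨y, fun z => Set.ext_iff.1 hy z⟩

/-- The other point of the class of `x` under `R 0 ∪ R 4`. -/
noncomputable def antipode (x : X) : X := (h.exists_antipode x).choose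

theorem rel_four_iff {x y : X} : S.R 4 x y ↔ y = h.antipode x :=
  (h.exists_antipode x).choose_spec y

theorem rel_antipode (x : X) : S.R 4 x (h.antipode x) := h.rel_four_iff.2 rfl

theorem antipode_antipode (x : X) : h.antipode (h.antipode x) = x :=
  (h.rel_four_iff.1 (S.symm _ _ _ (h.rel_antipode x))).symm

theorem antipode_ne (x : X) : h.antipode x ≠ x := fun hx => by
  have h4 := h.rel_antipode x
  rw [hx] at h4
  exact absurd (S.eq_of_rel h4 ((S.zero_iff x x).2 rfl)) (by decide)

theorem rel_antipode_left {k : Fin 5} {x y : X} (hk : S.R k x y) :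
    S.R (Fin.rev k) (h.antipode x) y := by
  obtain ⟨i, hi, hp⟩ := (h.classes (Fin.rev k) k).2 (Or.inr rfl)
  rw [← S.inter i _ k x y hk] at hp
  obtain ⟨z, hz1, hz2⟩ := Set.nonempty_of_ncard_ne_zero hp
  rcases hi with rfl | rfl
  -- When the witness comes from `R 0`, the index `k` is fixed by `Fin.rev`. The index of the pair
  -- `(antipode x, y)` lies in the class of `k`, hence is `k` itself.
  · obtain rfl := (S.zero_iff _ _).1 hz1
    have hkk : Fin.rev k = k := S.eq_of_rel hz2 hk
    obtain ⟨j, hj, -⟩ := S.partition (h.antipode x) y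
    have hpj : S.p 4 j k ≠ 0 := by
      rw [← S.inter 4 j k x y hk]
      exact Set.ncard_ne_zero_of_mem (a := h.antipode x) ⟨h.rel_antipode x, hj⟩
    rcases (h.classes j k).1 ⟨4, by simp, hpj⟩ with rfl | rfl
    · rwa [hkk]
    · exact hj
  · rwa [← h.rel_four_iff.1 hz1]

theorem rel_antipode_right {k : Fin 5} {x y : X} (hk : S.R k x y) :
    S.R (Fin.rev k) x (h.antipode y) :=
  S.symm _ _ _ (h.rel_antipode_left (S.symm _ _ _ hk))

theorem proj_eq_iff {x y : X} : h.proj x = h.proj y ↔ y = x ∨ y = h.antipode x := by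
  have hp : h.proj x = h.proj y ↔ S.R 0 x y ∨ S.R 4 x y :=
    Quotient.eq (r := (⟨_, h.equiv⟩ : Setoid X))
  rw [hp, S.zero_iff, h.rel_four_iff, eq_comm]

theorem proj_antipode (x : X) : h.proj (h.antipode x) = h.proj x :=
  (h.proj_eq_iff.2 (Or.inr rfl)).symm

/-- Independence of representatives: passing to antipodes changes `i` at most to `4 - i`, and each
index class is stable under this reversal. -/
theorem quoRel_proj_iff {i : Fin 5} {x y : X} (hi : S.R i x y) (j : Fin 3) :
    h.quoRel j (h.proj x) (h.proj y) ↔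
      i ∈ (![{0, 4}, {1, 3}, {2}] : Fin 3 → Set (Fin 5)) j := by
  refine ⟨?_, fun hj => ⟨x, y, rfl, rfl, i, hj, hi⟩⟩
  rintro ⟨x', y', hx, hy, i', hi', hr⟩
  have hii : i = i' ∨ i = Fin.rev i' := by
    rcases h.proj_eq_iff.1 hx with rfl | rfl <;> rcases h.proj_eq_iff.1 hy with rfl | rfl
    · exact Or.inl (S.eq_of_rel hi hr)
    · exact Or.inr (S.eq_of_rel hi (h.rel_antipode_right hr))
    · exact Or.inr (S.eq_of_rel hi (h.rel_antipode_left hr))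
    · have := h.rel_antipode_right (h.rel_antipode_left hr)
      rw [Fin.rev_rev] at this
      exact Or.inl (S.eq_of_rel hi this)
  rcases hii with rfl | rfl
  · exact hi'
  · rw [mem_indexClass_iff] at hi' ⊢
    rw [← hi']
    fin_cases i' <;> rfl

theorem secondEigenmatrix_apply {E : Fin 3 → Matrix h.Quo h.Quo ℝ}
    {Q : Matrix (Fin 3) (Fin 3) ℝ} (hQ : IsSecondEigenmatrix h.quoRel E Q) (l j : Fin 3)
    {i : Fin 5} (hi : i ∈ (![{0, 4}, {1, 3}, {2}] : Fin 3 → Set (Fin 5)) j) {x y : X}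
    (hxy : S.R i x y) :
    E l (h.proj x) (h.proj y) = (Fintype.card h.Quo : ℝ)⁻¹ * Q j l := by
  rw [hQ l, Matrix.smul_apply, Matrix.sum_apply, smul_eq_mul, Finset.sum_eq_single j]
  · simp [relMatrix, (h.quoRel_proj_iff hxy j).2 hi]
  · intro j' _ hj'
    have : ¬ h.quoRel j' (h.proj x) (h.proj y) := by
      rw [h.quoRel_proj_iff hxy, mem_indexClass_iff]
      exact fun hi' => hj' (hi'.symm.trans ((mem_indexClass_iff j i).1 hi))
    simp [relMatrix, this]
  · simp

theorem sum_lift_apply {Ebar : Fin 3 → Matrix h.Quo h.Quo ℝ}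
    (hsum : ∑ i, Ebar i = 1) {E : Fin 5 → Matrix X X ℝ}
    (hlift : ∀ (i : Fin 3) (x y : X),
      E (i.castLE (by norm_num)) x y = 1 / 2 * Ebar i (h.proj x) (h.proj y)) (x y : X) :
    (E 0 + E 1 + E 2) x y = if h.proj x = h.proj y then 1 / 2 else 0 := by
  have h0 := hlift 0 x y
  have h1 := hlift 1 x y
  have h2 := hlift 2 x y
  have hs := congr_fun₂ hsum (h.proj x) (h.proj y)
  simp only [Fin.sum_univ_three, Matrix.add_apply, Matrix.one_apply] at hs
  change E 0 x y = _ at h0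
  change E 1 x y = _ at h1
  change E 2 x y = _ at h2
  rw [Matrix.add_apply, Matrix.add_apply, h0, h1, h2, ← mul_add, ← mul_add, hs]
  simp

/-- `E i` is orthogonal to the projection `E 0 + E 1 + E 2`, whose column at `y` is `1 / 2` on the
antipodal pair of `y` and zero elsewhere; so the two entries of `E i` over each pair cancel. -/
theorem apply_antipode_right [DecidableEq X] {Ebar : Fin 3 → Matrix h.Quo h.Quo ℝ}
    (hsum : ∑ i, Ebar i = 1) {E : Fin 5 → Matrix X X ℝ} (hE : IsPrimitiveIdempotents S.R E)
    (hlift : ∀ (i : Fin 3) (x y : X),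
      E (i.castLE (by norm_num)) x y = 1 / 2 * Ebar i (h.proj x) (h.proj y))
    {i : Fin 5} (hi : i = 3 ∨ i = 4) (x y : X) : E i x (h.antipode y) = - E i x y := by
  have h0 : E i * (E 0 + E 1 + E 2) = 0 := by
    rw [Matrix.mul_add, Matrix.mul_add]
    rcases hi with rfl | rfl <;> simp [hE.orth]
  have := congr_fun₂ h0 x y
  rw [Matrix.mul_apply] at this
  simp only [h.sum_lift_apply hsum hlift, Matrix.zero_apply] at this
  rw [← Finset.sum_subset (Finset.subset_univ {y, h.antipode y}),
    Finset.sum_pair (h.antipode_ne y).symm] at this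
  · simp only [h.proj_antipode, if_true] at this
    linarith
  · intro z _ hz
    have : h.proj z ≠ h.proj y := fun he => hz <| by
      rcases h.proj_eq_iff.1 he.symm with rfl | rfl <;> simp
    simp [this]

end AssociationScheme.IsTwofoldCover

/-! ### Eigenvalues of `R 2` and the clique bound -/

namespace AssociationScheme.IsTwofoldCover

variable {X : Type*} [Fintype X] {S : AssociationScheme X 4} (h : S.IsTwofoldCover)

/-- Evaluate `A_2 = ∑ P_{j,2} E_j` at `(x, y)` and at `(x, antipode y)` and add: the odd idempotents
cancel, leaving only quotient data. -/
theorem sum_firstEigenmatrix_mul_secondEigenmatrix [DecidableEq X]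
    {E : Fin 5 → Matrix X X ℝ} (hE : IsPrimitiveIdempotents S.R E)
    {P : Matrix (Fin 5) (Fin 5) ℝ} (hP : IsFirstEigenmatrix S.R E P)
    {Ebar : Fin 3 → Matrix h.Quo h.Quo ℝ} (hsum : ∑ i, Ebar i = 1)
    {Qbar : Matrix (Fin 3) (Fin 3) ℝ} (hQbar : IsSecondEigenmatrix h.quoRel Ebar Qbar)
    (hlift : ∀ (i : Fin 3) (x y : X),
      E (i.castLE (by norm_num)) x y = 1 / 2 * Ebar i (h.proj x) (h.proj y))
    (i : Fin 5) (j : Fin 3) (hj : i ∈ (![{0, 4}, {1, 3}, {2}] : Fin 3 → Set (Fin 5)) j) :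
    P 0 2 * Qbar j 0 + P 1 2 * Qbar j 1 + P 2 2 * Qbar j 2 =
      Fintype.card h.Quo * (if i = 2 then 2 else 0) := by
  obtain ⟨x, y, hxy⟩ := S.nonempty i
  have hn : (Fintype.card h.Quo : ℝ) ≠ 0 := by
    have : Nonempty h.Quo := ⟨h.proj x⟩
    exact_mod_cast Fintype.card_ne_zero
  have hA : ∀ {k : Fin 5} {z : X}, S.R k x z →
      relMatrix (S.R 2) x z = if k = 2 then 1 else 0 := fun {k z} hk => by
    by_cases h2 : k = 2
    · subst h2; simp [relMatrix, hk]
    · have : ¬ S.R 2 x z := fun h' => h2 (S.eq_of_rel hk h')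
      simp [relMatrix, h2, this]
  have hrev : Fin.rev i = 2 ↔ i = 2 := by
    clear hxy hj
    fin_cases i <;> decide
  have hA2 : relMatrix (S.R 2) =
      P 0 2 • E 0 + P 1 2 • E 1 + P 2 2 • E 2 + P 3 2 • E 3 + P 4 2 • E 4 :=
    (hP 2).trans (Fin.sum_univ_five _)
  have e1 := congr_fun₂ hA2 x y
  have e2 := congr_fun₂ hA2 x (h.antipode y)
  rw [hA hxy] at e1
  rw [hA (h.rel_antipode_right hxy)] at e2
  simp only [hrev, Matrix.add_apply, Matrix.smul_apply, smul_eq_mul,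
    h.apply_antipode_right hsum hE hlift (Or.inl rfl : (3 : Fin 5) = 3 ∨ _),
    h.apply_antipode_right hsum hE hlift (Or.inr rfl : _ ∨ (4 : Fin 5) = 4)] at e1 e2
  have hval : ∀ (l : Fin 3) (z : X), h.proj z = h.proj y → E (l.castLE (by norm_num)) x z =
      1 / 2 * ((Fintype.card h.Quo : ℝ)⁻¹ * Qbar j l) := fun l z hz => by
    rw [hlift, hz, h.secondEigenmatrix_apply hQbar l j hj hxy]
  have v0 : ∀ z, h.proj z = h.proj y → E 0 x z = _ := hval 0
  have v1 : ∀ z, h.proj z = h.proj y → E 1 x z = _ := hval 1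
  have v2 : ∀ z, h.proj z = h.proj y → E 2 x z = _ := hval 2
  rw [v0 y rfl, v1 y rfl, v2 y rfl] at e1
  rw [v0 _ (h.proj_antipode y), v1 _ (h.proj_antipode y), v2 _ (h.proj_antipode y)] at e2
  have e4 : (Fintype.card h.Quo : ℝ)⁻¹ * (P 0 2 * Qbar j 0 + P 1 2 * Qbar j 1 + P 2 2 * Qbar j 2)
      = if i = 2 then 2 else 0 := by
    split_ifs at e1 e2 ⊢ <;> linarith
  rw [← e4, mul_inv_cancel_left₀ hn]

theorem spread_parameters [DecidableEq X]
    {E : Fin 5 → Matrix X X ℝ} (hE : IsPrimitiveIdempotents S.R E)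
    {P Q : Matrix (Fin 5) (Fin 5) ℝ} (hP : IsFirstEigenmatrix S.R E P)
    (hQ : IsSecondEigenmatrix S.R E Q)
    {Ebar : Fin 3 → Matrix h.Quo h.Quo ℝ} (hsum : ∑ i, Ebar i = 1)
    {n m r s : ℝ} (hn : n = Fintype.card h.Quo) (hrs : s < r)
    (hQbar : IsSecondEigenmatrix h.quoRel Ebar
      !![1, m, n - m - 1; 1, r, -r - 1; 1, s, -s - 1])
    (hlift : ∀ (i : Fin 3) (x y : X),
      E (i.castLE (by norm_num)) x y = 1 / 2 * Ebar i (h.proj x) (h.proj y)) :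
    s < 0 ∧ P 0 2 / min (P 1 2) (P 2 2) = m / s := by
  obtain ⟨x, -, -⟩ := S.nonempty 0
  have hn0 : 0 < n := by
    have : Nonempty h.Quo := ⟨h.proj x⟩
    rw [hn]
    exact_mod_cast Fintype.card_pos
  have hX : (0 : ℝ) < Fintype.card X := by
    have : Nonempty X := ⟨x⟩
    exact_mod_cast Fintype.card_pos
  have q0 := h.sum_firstEigenmatrix_mul_secondEigenmatrix hE hP hsum hQbar hlift 0 0 (by simp)
  have q1 := h.sum_firstEigenmatrix_mul_secondEigenmatrix hE hP hsum hQbar hlift 1 1 (by simp)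
  have q2 := h.sum_firstEigenmatrix_mul_secondEigenmatrix hE hP hsum hQbar hlift 2 2 (by simp)
  simp [← hn] at q0 q1 q2
  have hk : 0 < P 0 2 := by
    rw [firstEigenmatrix_zero hE hP]
    exact_mod_cast S.p_pos 2
  have e1 : ∀ {k : Fin 5} {j : Fin 3} {y z : X},
      k ∈ (![{0, 4}, {1, 3}, {2}] : Fin 3 → Set (Fin 5)) j → S.R k y z →
      E 1 y z = 1 / 2 * (n⁻¹ * (![m, r, s] : Fin 3 → ℝ) j) := fun {k j y z} hj hr => by
    have := hlift 1 y z
    rw [h.secondEigenmatrix_apply hQbar 1 j hj hr, ← hn] at this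
    refine Eq.trans this ?_
    fin_cases j <;> rfl
  have e2 : E 2 x x = 1 / 2 * (n⁻¹ * (n - m - 1)) := by
    have := hlift 2 x x
    rw [h.secondEigenmatrix_apply hQbar 2 0 (i := 0) (by simp) ((S.zero_iff x x).2 rfl),
      ← hn] at this
    exact this
  have e1x := e1 (k := 0) (j := 0) (by simp) ((S.zero_iff x x).2 rfl)
  have hpos : ∀ i, 0 < E i x x := fun i => by
    have h1 := hE.trace_pos hQ i
    rw [← hQ.card_mul_diag i x] at h1
    exact pos_of_mul_pos_right h1 hX.le
  have hm : 0 < m := by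
    have h1 := hpos 1
    rw [e1x] at h1
    have : 0 < n⁻¹ := by positivity
    simp only [Matrix.cons_val_zero] at h1
    by_contra hle
    push Not at hle
    nlinarith [mul_nonneg this.le (neg_nonneg.2 hle)]
  have hm2 : 0 < n - m - 1 := by
    have h1 := hpos 2
    rw [e2] at h1
    have : 0 < n⁻¹ := by positivity
    by_contra hle
    push Not at hle
    nlinarith [mul_nonneg this.le (neg_nonneg.2 hle)]
  -- Subtracting `q1` from `q2` gives `(r - s) (P 2 2 - P 1 2) = 2 n > 0`. Thus the minimum `θ` is
  -- `P 1 2`, and `q0` then forces it to be negative.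
  have hlt : P 1 2 < P 2 2 := by
    by_contra hle
    push Not at hle
    nlinarith [mul_nonneg (sub_nonneg.2 hrs.le) (sub_nonneg.2 hle)]
  have hneg : P 1 2 < 0 := by
    by_contra hle
    push Not at hle
    have h1 := mul_nonneg hle hm.le
    have h2 := mul_pos (hle.trans_lt hlt) hm2
    linarith
  -- Compare diagonal entries in `A_2 E_1 = P_{1,2} E_1`: `E 1` is `s / (2 n)` on `R 2` and `m / (2
  -- n)` on the diagonal.
  have htr : P 0 2 * s = P 1 2 * m := by
    have h1 := congr_fun₂ (hP.mul_idem hE 2 1) x x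
    have hterm : ∀ z ∈ Finset.univ, relMatrix (S.R 2) x z * E 1 z x =
        relMatrix (S.R 2) x z * (1 / 2 * (n⁻¹ * s)) := fun z _ => by
      by_cases hz : S.R 2 x z
      · rw [e1 (j := 2) (by simp) (S.symm _ _ _ hz)]
        rfl
      · simp [relMatrix, hz]
    rw [Matrix.mul_apply, Finset.sum_congr rfl hterm, ← Finset.sum_mul, sum_relMatrix_row,
      ← firstEigenmatrix_zero hE hP, Matrix.smul_apply, smul_eq_mul, e1x] at h1
    simp only [Matrix.cons_val_zero] at h1
    field_simp at h1
    exact h1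
  have hs : s < 0 := by
    by_contra hle
    push Not at hle
    nlinarith [mul_nonneg hk.le hle, mul_pos (neg_pos.2 hneg) hm]
  refine ⟨hs, ?_⟩
  rw [min_eq_left hlt.le, div_eq_div_iff hneg.ne hs.ne, htr, mul_comm]

/-- The Hoffman–Delsarte bound for unions of antipodal pairs. -/
theorem card_clique_le [DecidableEq X]
    {E : Fin 5 → Matrix X X ℝ} (hE : IsPrimitiveIdempotents S.R E)
    {Q : Matrix (Fin 5) (Fin 5) ℝ} (hQ : IsSecondEigenmatrix S.R E Q)
    {Ebar : Fin 3 → Matrix h.Quo h.Quo ℝ}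
    {n m r s : ℝ} (hn : n = Fintype.card h.Quo) (hs : s < 0)
    (hQbar : IsSecondEigenmatrix h.quoRel Ebar
      !![1, m, n - m - 1; 1, r, -r - 1; 1, s, -s - 1])
    (hlift : ∀ (i : Fin 3) (x y : X),
      E (i.castLE (by norm_num)) x y = 1 / 2 * Ebar i (h.proj x) (h.proj y))
    {C : Finset X} (hne : C.Nonempty) (hC : ∀ x ∈ C, h.antipode x ∈ C)
    (hrel : ∀ x ∈ C, ∀ y ∈ C, y = x ∨ y = h.antipode x ∨ S.R 2 x y) :
    (C.card : ℝ) ≤ 2 * (1 - m / s) := by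
  have hn0 : 0 < n := by
    have : Nonempty h.Quo := ⟨h.proj hne.choose⟩
    rw [hn]
    exact_mod_cast Fintype.card_pos
  -- On `C` the idempotent is a constant `s` plus a correction `m - s` on each antipodal pair, up to
  -- the factor `1 / (2 n)`. Since `C` is antipodally closed, each row meets the correction exactly
  -- twice.
  have hentry : ∀ x ∈ C, ∀ y ∈ C, E 1 x y = 1 / 2 * n⁻¹ *
      (s + ((if x = y then m - s else 0) + if h.antipode x = y then m - s else 0)) := by
    intro x hx y hy
    have hl : E 1 x y = _ := hlift 1 x y
    rcases hrel x hx y hy with rfl | rfl | h2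
    · rw [hl, h.secondEigenmatrix_apply hQbar 1 0 (i := 0) (by simp) ((S.zero_iff y y).2 rfl),
        ← hn]
      simp [h.antipode_ne]
      ring
    · rw [hl, h.secondEigenmatrix_apply hQbar 1 0 (i := 4) (by simp) (h.rel_antipode x), ← hn]
      simp [(h.antipode_ne x).symm]
      ring
    · have h0 : x ≠ y := by
        rintro rfl
        exact absurd (S.eq_of_rel h2 ((S.zero_iff x x).2 rfl)) (by decide)
      have h4 : h.antipode x ≠ y := by
        rintro rfl
        exact absurd (S.eq_of_rel h2 (h.rel_antipode x)) (by decide)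
      rw [hl, h.secondEigenmatrix_apply hQbar 1 2 (by simp) h2, ← hn]
      simp [h0, h4]
      ring
  have hsum : ∑ x ∈ C, ∑ y ∈ C, E 1 x y =
      C.card * (1 / 2 * n⁻¹ * (C.card * s + 2 * (m - s))) := by
    rw [← nsmul_eq_mul, ← Finset.sum_const]
    refine Finset.sum_congr rfl fun x hx => ?_
    rw [Finset.sum_congr rfl (hentry x hx), ← Finset.mul_sum, Finset.sum_add_distrib,
      Finset.sum_add_distrib, Finset.sum_ite_eq, Finset.sum_ite_eq, if_pos hx, if_pos (hC x hx),
      Finset.sum_const, nsmul_eq_mul]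
    ring
  have hpos := sum_sum_nonneg_of_idem (hE.idem 1) (hQ.symm 1) C
  rw [hsum] at hpos
  have hcard : (0 : ℝ) < C.card := by exact_mod_cast hne.card_pos
  have h1 : 0 ≤ C.card * s + 2 * (m - s) :=
    nonneg_of_mul_nonneg_right (nonneg_of_mul_nonneg_right hpos hcard) (by positivity)
  have h2 : 2 * (1 - m / s) = (2 * (m - s)) / (-s) := by
    have := hs.ne
    field_simp
    ring
  rw [h2, le_div_iff₀ (neg_pos.2 hs)]
  linarith

end AssociationScheme.IsTwofoldCover

/-! ### Orthonormal bases and their transition matrices -/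

section Orthonormal

variable {F : Type*} [NormedAddCommGroup F] [InnerProductSpace ℝ F]
  {V : Submodule ℝ F} {N : ℕ} {u : Fin N → F}

theorem Orthonormal.codRestrict_submodule (hu : Orthonormal ℝ u) (hV : ∀ a, u a ∈ V) :
    Orthonormal ℝ fun a => (⟨u a, hV a⟩ : V) :=
  ⟨fun a => hu.1 a, fun _ _ hab => hu.2 hab⟩

theorem Orthonormal.card_le_finrank_submodule [FiniteDimensional ℝ V]
    (hu : Orthonormal ℝ u) (hV : ∀ a, u a ∈ V) :
    N ≤ finrank ℝ V := by
  simpa using (hu.codRestrict_submodule hV).linearIndependent.fintype_card_le_finrank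

theorem Orthonormal.exists_orthonormalBasis_submodule [FiniteDimensional ℝ V]
    (hu : Orthonormal ℝ u)
    (hV : ∀ a, u a ∈ V) (hN : finrank ℝ V = N) :
    ∃ b : OrthonormalBasis (Fin N) ℝ V, ∀ a, (b a : F) = u a := by
  have ho := hu.codRestrict_submodule hV
  refine ⟨OrthonormalBasis.mk ho ?_, fun a => by rw [OrthonormalBasis.coe_mk]⟩
  have hc : Fintype.card (Fin N) = finrank ℝ V := by rw [Fintype.card_fin, hN]
  rw [ho.linearIndependent.span_eq_top_of_card_eq_finrank' hc]

/-- Parseval's identity; it makes Gram matrices between orthonormal bases compose as transition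
matrices. -/
theorem Orthonormal.sum_inner_mul_inner_submodule [FiniteDimensional ℝ V]
    (hu : Orthonormal ℝ u)
    (hV : ∀ a, u a ∈ V) (hN : finrank ℝ V = N) {x y : F} (hx : x ∈ V) (hy : y ∈ V) :
    ∑ a, inner ℝ x (u a) * inner ℝ (u a) y = inner ℝ x y := by
  obtain ⟨b, hb⟩ := hu.exists_orthonormalBasis_submodule hV hN
  simpa [hb] using b.sum_inner_mul_inner ⟨x, hx⟩ ⟨y, hy⟩

theorem Orthonormal.isCrossPolytope [FiniteDimensional ℝ V]
    (hu : Orthonormal ℝ u)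
    (hV : ∀ a, u a ∈ V) (hN : finrank ℝ V = N) :
    IsCrossPolytope V ((Set.range u) ∪ Set.range fun t => -(u t)) := by
  subst hN
  obtain ⟨b, hb⟩ := hu.exists_orthonormalBasis_submodule hV rfl
  exact ⟨b, by simp only [hb]⟩

end Orthonormal

/-- Pairwise unbiased orthonormal bases, given by their transition matrices `G j l`, yield mutually
unbiased weighing matrices. -/
theorem exists_mutuallyUnbiasedWeighing {f N : ℕ} (hf : 2 ≤ f) (hN : 0 < N) {α : ℝ}
    (G : Fin f → Fin f → Matrix (Fin N) (Fin N) ℝ) (hone : ∀ j, G j j = 1)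
    (hmul : ∀ i j l, G i j * G j l = G i l) (htr : ∀ i j, (G i j).transpose = G j i)
    (hent : ∀ i j, i ≠ j → ∀ a b, G i j a b = 0 ∨ G i j a b = α ∨ G i j a b = -α) :
    ∃ w : ℕ, (w : ℝ) = 1 / α ^ 2 ∧
      ∃ W : Fin (f - 1) → Matrix (Fin N) (Fin N) ℝ, IsMutuallyUnbiasedWeighing W w := by
  obtain ⟨g, rfl⟩ : ∃ g, f = g + 2 := ⟨f - 2, by omega⟩
  -- Otherwise `G 0 1` vanishes, contradicting `G 0 1 * G 1 0 = 1`.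
  have hα : α ≠ 0 := by
    rintro rfl
    have h0 : G 0 1 = 0 := by
      ext a b
      simpa using hent 0 1 (by simp) a b
    have h1 := hmul 0 1 0
    rw [h0, hone, Matrix.zero_mul] at h1
    have := congr_fun₂ h1 ⟨0, hN⟩ ⟨0, hN⟩
    simp at this
  have hsq : ∀ i j, (G i j) * (G i j).transpose = 1 := fun i j => by rw [htr, hmul, hone]
  -- A row of `G 0 1` is a unit vector with entries `0, ±α`, so `1 / α ^ 2` counts its nonzero
  -- entries.
  have hw : ∃ w : ℕ, (w : ℝ) = 1 / α ^ 2 := by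
    have hc : ∀ b, ∃ c : ℕ, (c : ℝ) = (G 0 1 ⟨0, hN⟩ b) ^ 2 / α ^ 2 := fun b => by
      have hα2 : α ^ 2 ≠ 0 := pow_ne_zero 2 hα
      rcases hent 0 1 (by simp) ⟨0, hN⟩ b with h | h | h
      · exact ⟨0, by simp [h]⟩
      · exact ⟨1, by simp [h, hα2]⟩
      · exact ⟨1, by simp [h, hα2]⟩
    choose c hc using hc
    refine ⟨∑ b, c b, ?_⟩
    have h1 := congr_fun₂ (hsq 0 1) ⟨0, hN⟩ ⟨0, hN⟩
    rw [Matrix.mul_apply, Matrix.one_apply_eq] at h1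
    rw [Nat.cast_sum, Finset.sum_congr rfl fun b _ => hc b, ← Finset.sum_div, ← h1]
    simp [sq]
  obtain ⟨w, hw⟩ := hw
  -- Both signs are allowed because the products below are normalised by `√w = |α|⁻¹`, whereas the
  -- family itself uses `α⁻¹`.
  have hweigh : ∀ β : ℝ, (β = α ∨ β = -α) → ∀ i j, i ≠ j → IsWeighingMatrix (β⁻¹ • G i j) w := by
    intro β hβ i j hij
    have hβ0 : β ≠ 0 := by rcases hβ with rfl | rfl <;> simpa using hα
    refine ⟨fun a b => ?_, ?_⟩
    · rw [Matrix.smul_apply, smul_eq_mul]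
      rcases hβ with rfl | rfl <;> rcases hent i j hij a b with h | h | h <;>
        simp [h, hα, inv_neg]
    · rw [Matrix.transpose_smul, Matrix.smul_mul, Matrix.mul_smul, hsq, smul_smul, hw]
      congr 1
      rcases hβ with rfl | rfl <;> field_simp
  have habs : √(w : ℝ) = |α|⁻¹ := by
    rw [hw, ← sq_abs, one_div, ← inv_pow, Real.sqrt_sq (by positivity)]
  -- Basis `0` serves as reference, leaving `f - 1` matrices; `G j 0 * G 0 l = G j l` supplies
  -- unbiasedness.
  refine ⟨w, hw, fun j => α⁻¹ • G (Fin.succ (n := g + 1) j) 0,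
    fun j => hweigh α (Or.inl rfl) _ _ (Fin.succ_ne_zero _), fun j l hjl =>
    ⟨|α|⁻¹ • G (Fin.succ (n := g + 1) j) (Fin.succ (n := g + 1) l),
      hweigh _ (abs_choice α) _ _ fun h => hjl (Fin.succ_injective _ h), ?_⟩⟩
  rw [Matrix.transpose_smul, Matrix.smul_mul, Matrix.mul_smul, htr, hmul, smul_smul, smul_smul,
    habs, ← mul_inv, ← mul_inv, abs_mul_abs_self]

/-! ### Cliques, transversals and antipodal closure -/

namespace AssociationScheme.IsTwofoldCover

variable {X : Type*} [Fintype X] {S : AssociationScheme X 4} (h : S.IsTwofoldCover)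

theorem rel_two_ne {x y : X} (hr : S.R 2 x y) : y ≠ x ∧ y ≠ h.antipode x := by
  constructor
  · rintro rfl
    exact absurd (S.eq_of_rel hr ((S.zero_iff y y).2 rfl)) (by decide)
  · rintro rfl
    exact absurd (S.eq_of_rel hr (h.rel_antipode x)) (by decide)

theorem clique_cases {C : Set X} (hC : S.IsClique {0, 2, 4} C) {x y : X}
    (hx : x ∈ C) (hy : y ∈ C) : y = x ∨ y = h.antipode x ∨ S.R 2 x y := by
  obtain ⟨i, hi, -⟩ := S.partition x y
  have hmem : i ∈ ({0, 2, 4} : Set (Fin 5)) := by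
    rw [← hC]
    exact ⟨x, hx, y, hy, hi⟩
  rcases hmem with rfl | rfl | rfl
  · exact Or.inl ((S.zero_iff x y).1 hi).symm
  · exact Or.inr (Or.inr hi)
  · exact Or.inr (Or.inl (h.rel_four_iff.1 hi))

/-- A set closed under the antipodal map has a transversal of the antipodal pairs. -/
theorem exists_transversal {C : Set X} (hC : ∀ x ∈ C, h.antipode x ∈ C) :
    ∃ (N : ℕ) (T : Fin N → X), C.ncard = 2 * N ∧ Function.Injective T ∧ (∀ a, T a ∈ C) ∧
      (∀ a b, T a ≠ h.antipode (T b)) ∧ ∀ x ∈ C, ∃ a, x = T a ∨ x = h.antipode (T a) := by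
  classical
  -- `rep` depends only on the antipodal pair, so its fixed points in `C` form a transversal.
  let rep : X → X := fun x => Quotient.out (s := (⟨_, h.equiv⟩ : Setoid X)) (h.proj x)
  have hrep : ∀ x, h.proj (rep x) = h.proj x := fun x => Quotient.out_eq _
  have hrep' : ∀ x, rep x = x ∨ rep x = h.antipode x := fun x =>
    h.proj_eq_iff.1 (hrep x).symm
  have hanti : ∀ x, rep (h.antipode x) = rep x := fun x => by
    simp only [rep, h.proj_antipode]
  let D : Finset X := Finset.univ.filter fun x => x ∈ C ∧ rep x = x
  have hD : ∀ x, x ∈ D ↔ x ∈ C ∧ rep x = x := fun x => by simp [D]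
  have hinj : Function.Injective h.antipode :=
    Function.LeftInverse.injective h.antipode_antipode
  have hne : ∀ x ∈ D, ∀ y ∈ D, x ≠ h.antipode y := by
    intro x hx y hy hxy
    have h1 := ((hD x).1 hx).2
    rw [hxy, hanti, ((hD y).1 hy).2] at h1
    exact h.antipode_ne y h1.symm
  have hcov : ∀ x ∈ C, x ∈ D ∨ h.antipode x ∈ D := fun x hx => by
    rcases hrep' x with hx' | hx'
    · exact Or.inl ((hD x).2 ⟨hx, hx'⟩)
    · exact Or.inr ((hD _).2 ⟨hC x hx, by rw [hanti, hx']⟩)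
  refine ⟨D.card, fun a => (D.equivFin.symm a : X), ?_, ?_, fun a => ?_, fun a b => ?_,
    fun x hx => ?_⟩
  · have hCD : C = ((D ∪ D.image h.antipode : Finset X) : Set X) := by
      ext x
      simp only [Finset.coe_union, Finset.coe_image, Set.mem_union, Finset.mem_coe, Set.mem_image]
      constructor
      · exact fun hx => (hcov x hx).imp id fun hx' => ⟨_, hx', h.antipode_antipode x⟩
      · rintro (hx | ⟨y, hy, rfl⟩)
        · exact ((hD x).1 hx).1
        · exact hC y ((hD y).1 hy).1
    rw [hCD, Set.ncard_coe_finset, Finset.card_union_of_disjoint,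
      Finset.card_image_of_injective _ hinj, two_mul]
    rw [Finset.disjoint_left]
    intro x hx hx'
    obtain ⟨y, hy, rfl⟩ := Finset.mem_image.1 hx'
    exact hne _ hx y hy rfl
  · exact Subtype.val_injective.comp D.equivFin.symm.injective
  · exact ((hD _).1 (D.equivFin.symm a).2).1
  · exact hne _ (D.equivFin.symm a).2 _ (D.equivFin.symm b).2
  · rcases hcov x hx with hx' | hx'
    · exact ⟨D.equivFin ⟨x, hx'⟩, Or.inl (by simp)⟩
    · exact ⟨D.equivFin ⟨_, hx'⟩, Or.inr (by simp [h.antipode_antipode])⟩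

/-- Adjoining all antipodes to `C` creates no new relations beyond `R 0`, `R 2`, `R 4`, since `R 2`
is preserved by the antipodal map on either side. The enlarged set obeys the bound that `C` attains,
so nothing was added. -/
theorem antipode_mem_of_card_eq [DecidableEq X]
    {E : Fin 5 → Matrix X X ℝ} (hE : IsPrimitiveIdempotents S.R E)
    {Q : Matrix (Fin 5) (Fin 5) ℝ} (hQ : IsSecondEigenmatrix S.R E Q)
    {Ebar : Fin 3 → Matrix h.Quo h.Quo ℝ}
    {n m r s : ℝ} (hn : n = Fintype.card h.Quo) (hs : s < 0)
    (hQbar : IsSecondEigenmatrix h.quoRel Ebar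
      !![1, m, n - m - 1; 1, r, -r - 1; 1, s, -s - 1])
    (hlift : ∀ (i : Fin 3) (x y : X),
      E (i.castLE (by norm_num)) x y = 1 / 2 * Ebar i (h.proj x) (h.proj y))
    {C : Set X} (hC : S.IsClique {0, 2, 4} C) (hcard : (C.ncard : ℝ) = 2 * (1 - m / s))
    {x : X} (hx : x ∈ C) : h.antipode x ∈ C := by
  classical
  let D : Finset X := (C ∪ h.antipode '' C).toFinset
  have hD : ∀ y, y ∈ D ↔ y ∈ C ∨ h.antipode y ∈ C := fun y => by
    simp only [D, Set.mem_toFinset, Set.mem_union, Set.mem_image]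
    refine or_congr_right ⟨?_, fun hy => ⟨_, hy, h.antipode_antipode y⟩⟩
    rintro ⟨z, hz, rfl⟩
    rwa [h.antipode_antipode]
  have hrel2 : ∀ {y z}, S.R 2 (h.antipode y) z → S.R 2 y z := fun {y z} hr => by
    simpa [h.antipode_antipode] using (h.rel_antipode_left hr : S.R 2 _ _)
  have hrel2' : ∀ {y z}, S.R 2 y (h.antipode z) → S.R 2 y z := fun hr =>
    S.symm _ _ _ (hrel2 (S.symm _ _ _ hr))
  have hle : (D.card : ℝ) ≤ 2 * (1 - m / s) := by
    refine h.card_clique_le hE hQ hn hs hQbar hlift ⟨x, (hD x).2 (Or.inl hx)⟩ ?_ ?_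
    · intro y hy
      rw [hD, h.antipode_antipode]
      exact ((hD y).1 hy).symm
    · intro y hy z hz
      rcases (hD y).1 hy with hy | hy <;> rcases (hD z).1 hz with hz | hz
      · exact h.clique_cases hC hy hz
      · rcases h.clique_cases hC hy hz with e | e | e
        · exact Or.inr (Or.inl (by rw [← e, h.antipode_antipode]))
        · exact Or.inl (by rw [← h.antipode_antipode z, e, h.antipode_antipode])
        · exact Or.inr (Or.inr (hrel2' e))
      · rcases h.clique_cases hC hy hz with e | e | e
        · exact Or.inr (Or.inl e)
        · exact Or.inl (by rw [e, h.antipode_antipode])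
        · exact Or.inr (Or.inr (hrel2 e))
      · rcases h.clique_cases hC hy hz with e | e | e
        · exact Or.inl (by rw [← h.antipode_antipode z, e, h.antipode_antipode])
        · exact Or.inr (Or.inl (by
            rw [← h.antipode_antipode z, e, h.antipode_antipode]))
        · exact Or.inr (Or.inr (hrel2 (hrel2' e)))
  have hsub : C ⊆ (D : Set X) := fun y hy => (hD y).2 (Or.inl hy)
  have heq : C = (D : Set X) := by
    refine Set.eq_of_subset_of_ncard_le hsub ?_ (Set.toFinite _)
    rw [Set.ncard_coe_finset]
    exact_mod_cast hle.trans_eq hcard.symm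
  rw [heq]
  exact (hD _).2 (Or.inr (by rwa [h.antipode_antipode]))

end AssociationScheme.IsTwofoldCover

/-! ### Odd idempotents and the embedding of cliques -/

namespace AssociationScheme.IsTwofoldCover

variable {X : Type*} [Fintype X] {S : AssociationScheme X 4} (h : S.IsTwofoldCover)

/-- `E` is a symmetric idempotent of the Bose–Mesner algebra with coefficients `q` (up to the
factor `|X|`), supported on the functions which are antisymmetric under the antipodal map. -/
structure IsOddIdempotent [DecidableEq X] (h : S.IsTwofoldCover) (E : Matrix X X ℝ)
    (q : Fin 5 → ℝ) : Prop where
  idem : E * E = E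
  symm : ∀ x y, E x y = E y x
  pos : 0 < q 0
  apply : ∀ {k x y}, S.R k x y → E x y = (Fintype.card X : ℝ)⁻¹ * q k
  antipode_right : ∀ x y, E x (h.antipode y) = - E x y
  finrank : (finrank ℝ (idemSpace E) : ℝ) = q 0

namespace IsOddIdempotent

variable [DecidableEq X] {h} {E : Matrix X X ℝ} {q : Fin 5 → ℝ}

theorem coeff_rev (hE : h.IsOddIdempotent E q) (k : Fin 5) : q (Fin.rev k) = - q k := by
  obtain ⟨x, y, hxy⟩ := S.nonempty k
  have hX : (Fintype.card X : ℝ)⁻¹ ≠ 0 := by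
    have : Nonempty X := ⟨x⟩
    exact inv_ne_zero (by exact_mod_cast Fintype.card_ne_zero)
  have := hE.antipode_right x y
  rw [hE.apply hxy, hE.apply (h.rel_antipode_right hxy), ← mul_neg] at this
  exact mul_left_cancel₀ hX this

/-- The index `2` is fixed by `k ↦ 4 - k`. This vanishing is what makes `R 2` the orthogonality
relation of the embedding. -/
theorem coeff_two (hE : h.IsOddIdempotent E q) : q 2 = 0 := by
  have : q 2 = - q 2 := hE.coeff_rev 2
  linarith

theorem inner_eq (hE : h.IsOddIdempotent E q) {k : Fin 5} {x y : X} (hk : S.R k x y) :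
    inner ℝ (sphericalEmbedding E (q 0) x) (sphericalEmbedding E (q 0) y) = q k / q 0 := by
  have hX : (Fintype.card X : ℝ) ≠ 0 := by
    have : Nonempty X := ⟨x⟩
    exact_mod_cast Fintype.card_ne_zero
  rw [inner_sphericalEmbedding hE.idem hE.symm hE.pos.le, hE.apply hk]
  field_simp

theorem inner_self (hE : h.IsOddIdempotent E q) (x : X) :
    inner ℝ (sphericalEmbedding E (q 0) x) (sphericalEmbedding E (q 0) x) = (1 : ℝ) := by
  rw [hE.inner_eq ((S.zero_iff x x).2 rfl), div_self hE.pos.ne']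

theorem embedding_antipode (hE : h.IsOddIdempotent E q) (x : X) :
    sphericalEmbedding E (q 0) (h.antipode x) = - sphericalEmbedding E (q 0) x := by
  ext y
  simp [sphericalEmbedding, hE.antipode_right]

theorem mem (_ : h.IsOddIdempotent E q) (x : X) : sphericalEmbedding E (q 0) x ∈ idemSpace E :=
  mem_idemSpace_of_col E _ x

theorem orthonormal (hE : h.IsOddIdempotent E q) {C : Set X} (hC : S.IsClique {0, 2, 4} C)
    {N : ℕ} {T : Fin N → X} (hT : Function.Injective T) (hTC : ∀ a, T a ∈ C) (hTa : ∀ a b, T a ≠ h.antipode (T b)) :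
    Orthonormal ℝ fun a => sphericalEmbedding E (q 0) (T a) := by
  rw [orthonormal_iff_ite]
  intro a b
  split_ifs with hab
  · rw [hab, hE.inner_self]
  · rcases h.clique_cases hC (hTC a) (hTC b) with e | e | e
    · exact absurd (hT e).symm hab
    · exact absurd e (hTa b a)
    · rw [hE.inner_eq e, hE.coeff_two, zero_div]

/-- Equal images would have inner product `1`, but distinct points of a clique give `-1` or `0`. -/
theorem injOn (hE : h.IsOddIdempotent E q) {C : Set X} (hC : S.IsClique {0, 2, 4} C) :
    Set.InjOn (sphericalEmbedding E (q 0)) C := by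
  intro x hx y hy hxy
  have h1 := hE.inner_self x
  nth_rw 2 [hxy] at h1
  rcases h.clique_cases hC hx hy with e | e | e
  · exact e.symm
  · subst e
    have h2 := hE.inner_self x
    rw [hE.embedding_antipode, inner_neg_right, h2] at h1
    norm_num at h1
  · rw [hE.inner_eq e, hE.coeff_two, zero_div] at h1
    norm_num at h1

theorem isCrossPolytope (hE : h.IsOddIdempotent E q) {C : Set X} (hC : S.IsClique {0, 2, 4} C)
    (hanti : ∀ x ∈ C, h.antipode x ∈ C) (hcard : (C.ncard : ℝ) = 2 * q 0) :
    IsCrossPolytope (idemSpace E) (sphericalEmbedding E (q 0) '' C) := by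
  obtain ⟨N, T, hN, hT, hTC, hTa, hcov⟩ := h.exists_transversal hanti
  have hfin : Module.finrank ℝ (idemSpace E) = N := by
    rw [hN] at hcard
    push_cast at hcard
    have := hE.finrank
    have h3 : (Module.finrank ℝ (idemSpace E) : ℝ) = N := by linarith
    exact_mod_cast h3
  convert (hE.orthonormal hC hT hTC hTa).isCrossPolytope (fun a => hE.mem _) hfin
  ext v
  simp only [Set.mem_image, Set.mem_union, Set.mem_range]
  constructor
  · rintro ⟨x, hx, rfl⟩
    obtain ⟨a, rfl | rfl⟩ := hcov x hx
    · exact Or.inl ⟨a, rfl⟩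
    · exact Or.inr ⟨a, (hE.embedding_antipode _).symm⟩
  · rintro (⟨a, rfl⟩ | ⟨a, rfl⟩)
    · exact ⟨_, hTC a, rfl⟩
    · exact ⟨_, hanti _ (hTC a), hE.embedding_antipode _⟩

theorem card_clique_le (hE : h.IsOddIdempotent E q) {C : Set X} (hC : S.IsClique {0, 2, 4} C)
    (hanti : ∀ x ∈ C, h.antipode x ∈ C) : (C.ncard : ℝ) ≤ 2 * q 0 := by
  obtain ⟨N, T, hN, hT, hTC, hTa, -⟩ := h.exists_transversal hanti
  have hle := (hE.orthonormal hC hT hTC hTa).card_le_finrank_submodule fun a => hE.mem _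
  rw [hN, ← hE.finrank]
  push_cast
  have : (N : ℝ) ≤ Module.finrank ℝ (idemSpace E) := by exact_mod_cast hle
  linarith

theorem inner_cases (hE : h.IsOddIdempotent E q) {x y : X} (h0 : y ≠ x) (h4 : y ≠ h.antipode x) :
    inner ℝ (sphericalEmbedding E (q 0) x) (sphericalEmbedding E (q 0) y) = (0 : ℝ) ∨
    inner ℝ (sphericalEmbedding E (q 0) x) (sphericalEmbedding E (q 0) y) = q 1 / q 0 ∨
    inner ℝ (sphericalEmbedding E (q 0) x) (sphericalEmbedding E (q 0) y) = -(q 1 / q 0) := by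
  obtain ⟨k, hk, -⟩ := S.partition x y
  rw [hE.inner_eq hk]
  fin_cases k
  · exact absurd ((S.zero_iff x y).1 hk).symm h0
  · exact Or.inr (Or.inl rfl)
  · exact Or.inl (by simp [hE.coeff_two])
  · refine Or.inr (Or.inr ?_)
    have : q 3 = - q 1 := hE.coeff_rev 1
    change q 3 / q 0 = _
    rw [this, neg_div]
  · exact absurd (h.rel_four_iff.1 hk) h4

theorem exists_mutuallyUnbiasedWeighing (hE : h.IsOddIdempotent E q) {f : ℕ}
    (hf : 2 ≤ f) {Y : Fin f → Set X}
    (hY : ∀ j, S.IsClique {0, 2, 4} (Y j)) (hdisj : Pairwise fun i j => Disjoint (Y i) (Y j))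
    (hanti : ∀ j, ∀ x ∈ Y j, h.antipode x ∈ Y j) {N : ℕ} (hN : (N : ℝ) = q 0)
    (hcard : ∀ j, (Y j).ncard = 2 * N) :
    ∃ w : ℕ, (w : ℝ) = 1 / (q 1 / q 0) ^ 2 ∧
      ∃ W : Fin (f - 1) → Matrix (Fin N) (Fin N) ℝ, IsMutuallyUnbiasedWeighing W w := by
  have hT : ∀ j, ∃ T : Fin N → X, (∀ a, T a ∈ Y j) ∧
      Orthonormal ℝ fun a => sphericalEmbedding E (q 0) (T a) := fun j => by
    obtain ⟨M, T, hM, hT, hTC, hTa, -⟩ := h.exists_transversal (hanti j)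
    obtain rfl : M = N := by
      have := hcard j
      omega
    exact ⟨T, hTC, hE.orthonormal (hY j) hT hTC hTa⟩
  choose T hTY hTo using hT
  have hfin : Module.finrank ℝ (idemSpace E) = N := by
    have := hE.finrank
    rw [← hN] at this
    exact_mod_cast this
  have hpos : 0 < N := by
    have := hE.pos
    rw [← hN] at this
    exact_mod_cast this
  refine _root_.exists_mutuallyUnbiasedWeighing hf hpos
    (fun j l => Matrix.of fun a b => inner ℝ (sphericalEmbedding E (q 0) (T j a))
      (sphericalEmbedding E (q 0) (T l b))) (fun j => ?_) (fun i j l => ?_) (fun i j => ?_)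
    fun i j hij a b => ?_
  · ext a b
    rw [Matrix.of_apply, orthonormal_iff_ite.1 (hTo j) a b, Matrix.one_apply]
  · ext a b
    simp only [Matrix.mul_apply, Matrix.of_apply]
    exact (hTo j).sum_inner_mul_inner_submodule (fun _ => hE.mem _) hfin (hE.mem _) (hE.mem _)
  · ext a b
    exact real_inner_comm (sphericalEmbedding E (q 0) (T j a)) (sphericalEmbedding E (q 0) (T i b))
  -- Disjoint antipodally closed cliques share neither points nor antipodes, which excludes the
  -- inner products `±1` coming from `R 0` and `R 4`.
  · have hnot : T j b ∉ Y i := fun hb => Set.disjoint_left.1 (hdisj hij) hb (hTY j b)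
    refine hE.inner_cases (fun e => hnot ?_) (fun e => hnot ?_)
    · rw [e]; exact hTY i a
    · rw [e]; exact hanti i _ (hTY i a)

end IsOddIdempotent

/-- The valencies of the fission scheme. -/
theorem ncard_fissionRel {f c : ℕ} {Y : Fin f → Set X}
    (hY : ∀ j, S.IsClique {0, 2, 4} (Y j)) (hdisj : Pairwise fun i j => Disjoint (Y i) (Y j))
    (hcov : ⋃ j, Y j = Set.univ) (hanti : ∀ j, ∀ x ∈ Y j, h.antipode x ∈ Y j)
    (hcard : ∀ j, (Y j).ncard = c) (i : Fin 6) (x : X) :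
    {y | S.fissionRel Y i x y}.ncard =
      (![1, S.p 1 1 0, S.p 2 2 0 - (c - 2), S.p 3 3 0, 1, c - 2] : Fin 6 → ℕ) i := by
  have h5 : {y | S.R 2 x y ∧ ∃ j, x ∈ Y j ∧ y ∈ Y j}.ncard = c - 2 := by
    obtain ⟨j, hj⟩ : ∃ j, x ∈ Y j := by
      have : x ∈ ⋃ j, Y j := hcov ▸ Set.mem_univ x
      simpa using this
    have hset : {y | S.R 2 x y ∧ ∃ j, x ∈ Y j ∧ y ∈ Y j} = Y j \ {x, h.antipode x} := by
      ext y
      simp only [Set.mem_ofPred_eq, Set.mem_sdiff, Set.mem_insert_iff, Set.mem_singleton_iff]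
      constructor
      · rintro ⟨hr, l, hl, hy⟩
        obtain rfl : l = j := by
          by_contra hne
          exact Set.disjoint_left.1 (hdisj hne) hl hj
        exact ⟨hy, fun e => e.elim (h.rel_two_ne hr).1 (h.rel_two_ne hr).2⟩
      · rintro ⟨hy, hne⟩
        rcases h.clique_cases (hY j) hj hy with e | e | e
        · exact absurd (Or.inl e) hne
        · exact absurd (Or.inr e) hne
        · exact ⟨e, j, hj, hy⟩
    -- The pair removed lies inside `Y j`, so the truncated subtraction `c - 2` is exact.
    rw [hset, Set.ncard_sdiff (Set.insert_subset hj (Set.singleton_subset_iff.2 (hanti j x hj))),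
      hcard, Set.ncard_pair (h.antipode_ne x).symm]
  fin_cases i
  · change {y | S.R 0 x y}.ncard = 1
    simp [S.zero_iff]
  · exact S.ncard_rel 1 x
  · have hset : {y | S.R 2 x y ∧ ¬ ∃ j, x ∈ Y j ∧ y ∈ Y j} =
        {y | S.R 2 x y} \ {y | S.R 2 x y ∧ ∃ j, x ∈ Y j ∧ y ∈ Y j} := by
      ext y
      simp only [Set.mem_ofPred_eq, Set.mem_sdiff]
      exact and_congr_right fun hr => not_congr ⟨fun hj => ⟨hr, hj⟩, And.right⟩
    change {y | S.R 2 x y ∧ ¬ ∃ j, x ∈ Y j ∧ y ∈ Y j}.ncard = S.p 2 2 0 - (c - 2)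
    rw [hset, Set.ncard_sdiff fun y hy => hy.1, h5, S.ncard_rel]
  · exact S.ncard_rel 3 x
  · exact h.valency x
  · exact h5

end AssociationScheme.IsTwofoldCover

/-! ### The theorem -/

theorem theorem4p1 {X : Type*} [Fintype X] [DecidableEq X]
    -- the two-fold cover, its primitive idempotents and eigenmatrices
    (S : AssociationScheme X 4) (h : S.IsTwofoldCover)
    (E : Fin 5 → Matrix X X ℝ) (hE : IsPrimitiveIdempotents S.R E)
    (P Q : Matrix (Fin 5) (Fin 5) ℝ)
    (hP : IsFirstEigenmatrix S.R E P) (hQ : IsSecondEigenmatrix S.R E Q)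
    -- the quotient scheme, its primitive idempotents and second eigenmatrix
    (Ebar : Fin 3 → Matrix h.Quo h.Quo ℝ) (hEbar : IsPrimitiveIdempotents h.quoRel Ebar)
    (n m r s : ℝ) (hn : n = Fintype.card h.Quo) (hrs : s < r)
    (hQbar : IsSecondEigenmatrix h.quoRel Ebar
      !![1, m, n - m - 1;
         1, r, -r - 1;
         1, s, -s - 1])
    -- the ordering `E_i = Ebar_i ⊗ J_2 / 2` for `i = 0, 1, 2`
    (hlift : ∀ (i : Fin 3) (x y : X),
      E (i.castLE (by norm_num)) x y = 1 / 2 * Ebar i (h.proj x) (h.proj y))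
    -- the partition into maximal cliques
    {f : ℕ} (Y : Fin f → Set X) (hY : S.IsSpread P Y) :
    -- `k` is the family of valencies of the fission scheme
    ∃ k : Fin 6 → ℕ, (∀ i x, {y | S.fissionRel Y i x y}.ncard = k i) ∧
      ((k 0 + k 4 + k 5 : ℕ) : ℝ) ≤ min (2 * Q 0 3) (2 * Q 0 4) ∧
      ∀ i : Fin 5, i = 3 ∨ i = 4 → ((k 0 + k 4 + k 5 : ℕ) : ℝ) = 2 * Q 0 i →
        IsCrossPolytopeDecomposition (idemSpace (E i)) (sphericalEmbedding (E i) (Q 0 i)) Y ∧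
        2 ≤ f ∧
        ∃ N w : ℕ, (N : ℝ) = 1 - m / s ∧ (w : ℝ) = 1 / (Q 1 i / Q 0 i) ^ 2 ∧
          ∃ W : Fin (f - 1) → Matrix (Fin N) (Fin N) ℝ, IsMutuallyUnbiasedWeighing W w := by
  obtain ⟨hs, hratio⟩ := h.spread_parameters hE hP hQ hEbar.sum_eq hn hrs hQbar hlift
  have hYcard : ∀ j, ((Y j).ncard : ℝ) = 2 * (1 - m / s) := fun j => by
    rw [hY.card j, hratio]
  have hanti : ∀ j, ∀ x ∈ Y j, h.antipode x ∈ Y j := fun j x hx =>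
    h.antipode_mem_of_card_eq hE hQ hn hs hQbar hlift (hY.clique j) (hYcard j) hx
  have hmem : ∀ x, ∃ j, x ∈ Y j := fun x => by
    have : x ∈ ⋃ j, Y j := hY.cover ▸ Set.mem_univ x
    simpa using this
  have hodd : ∀ i : Fin 5, i = 3 ∨ i = 4 → h.IsOddIdempotent (E i) fun k => Q k i := fun i hi =>
    { idem := hE.idem i
      symm := hQ.symm i
      pos := hE.trace_pos hQ i
      apply := hQ.apply i
      antipode_right := h.apply_antipode_right hEbar.sum_eq hE hlift hi
      finrank := hE.finrank_idemSpace hQ i }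
  -- A pair in `R 1` cannot lie in one clique, which later gives `2 ≤ f`; its first point also
  -- selects a nonempty clique whose half-size is `N`.
  obtain ⟨x₁, y₁, hxy₁⟩ := S.nonempty 1
  obtain ⟨j₀, hj₀⟩ := hmem x₁
  obtain ⟨N, -, hN, -⟩ := h.exists_transversal (hanti j₀)
  have hNr : (N : ℝ) = 1 - m / s := by
    have := hYcard j₀
    rw [hN] at this
    push_cast at this
    linarith
  have hcard : ∀ j, (Y j).ncard = 2 * N := fun j => by
    have := hYcard j
    rw [← hNr] at this
    exact_mod_cast this
  have hpos : 0 < N := by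
    have : 0 < (Y j₀).ncard := (Set.ncard_pos (Set.toFinite _)).2 ⟨x₁, hj₀⟩
    omega
  refine ⟨_, h.ncard_fissionRel hY.clique hY.disjoint hY.cover hanti hcard, ?_⟩
  -- The sum of the three valencies is the clique size; `0 < N` is needed for the natural-number
  -- subtraction.
  have hk : (1 + 1 + (2 * N - 2) : ℕ) = 2 * N := by omega
  change ((1 + 1 + (2 * N - 2) : ℕ) : ℝ) ≤ _ ∧
    ∀ i : Fin 5, _ → ((1 + 1 + (2 * N - 2) : ℕ) : ℝ) = _ → _
  rw [hk, ← hcard j₀]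
  refine ⟨le_min ((hodd 3 (Or.inl rfl)).card_clique_le (hY.clique j₀) (hanti j₀))
    ((hodd 4 (Or.inr rfl)).card_clique_le (hY.clique j₀) (hanti j₀)), fun i hi heq => ?_⟩
  have hf : 2 ≤ f := by
    by_contra hlt
    obtain ⟨j₁, hj₁⟩ := hmem y₁
    obtain rfl : j₀ = j₁ := Fin.ext (by omega)
    have : (1 : Fin 5) ∈ ({0, 2, 4} : Set (Fin 5)) := by
      rw [← hY.clique j₀]
      exact ⟨x₁, hj₀, y₁, hj₁, hxy₁⟩
    simp at this
  have hNi : (N : ℝ) = Q 0 i := by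
    rw [hcard] at heq
    push_cast at heq
    linarith
  obtain ⟨w, hw, hW⟩ := (hodd i hi).exists_mutuallyUnbiasedWeighing hf hY.clique hY.disjoint hanti
    hNi hcard
  refine ⟨⟨hY.cover, hY.disjoint, fun j => (hodd i hi).injOn (hY.clique j), fun j =>
    (hodd i hi).isCrossPolytope (hY.clique j) (hanti j) ?_⟩, hf, N, w, hNr, hw, hW⟩
  rw [hcard j, ← hcard j₀, heq]
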